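/- **Lemma 3.1 (contractions).** Let $\mathbb C_2=\mathbb C\otimes\mathbb H$ be the complex quaternions $\lambda=\lambda_0+\lambda_1e_1+\lambda_2e_2+\lambda_3e_3$ ($\lambda_j\in\mathbb C$, $e_1^2=e_2^2=-1$, $e_1e_2=-e_2e_1=e_3$), with norm $|\lambda|=(\sum_j|\lambda_j|^2)^{1/2}$ and conjugation $\bar\lambda=\lambda_0-\lambda_1e_1-\lambda_2e_2-\lambda_3e_3$. Identify $x\in\mathbb R^3$ with $x_0+x_1e_1+x_2e_2\in\mathbb C_2$. Let $q_1,q_2\in L^\infty(\mathbb R^3;\mathbb C_2)$ vanish outside a bounded set $\Omega\subset\mathbb R^3$. For functions $g:\mathbb R^3\to\mathbb C_2$ put $$Tg(x)=-\frac1{4\pi}\int_{\mathbb R^3}\frac{\overline{y-x}}{|y-x|^3}\,g(y)\,dy,\qquad \bar Tg(x)=-\frac1{4\pi}\int_{\mathbb R^3}\frac{y-x}{|y-x|^3}\,g(y)\,dy ,$$ and for $f=f(x,k)$, $f:\mathbb R^3\times\mathbb R^3\to\mathbb C_2$, put (for each fixed $k$, with $T,\bar T$ acting in the space variable) $$M^1f=T\big[e^{-ix\cdot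 k}\,\bar T[e^{ix\cdot k}f\,q_2]\,q_1\big],\qquad M^2f=\bar T\big[e^{ix\cdot k}\,T[e^{-ix\cdot k}f\,q_1]\,q_2\big].$$ For $R>0$ and $2<p<\infty$ let $S=S_R=L^\infty_x(L^p_k(|k|>R))$ be the space of (classes modulo a.e. equality of) measurable functions $f(x,k)$, $x\in\mathbb R^3$, $|k|>R$, with $$\|f\|_{S}=\operatorname*{ess\,sup}_{x\in\mathbb R^3}\Big(\int_{|k|>R}|f(x,k)|^p\,dk\Big)^{1/p}<\infty .$$ Then for every $R>0$ and $f\in S_R$ the integrals defining $M^1f(x,k)$ and $M^2f(x,k)$ converge absolutely for almost every $(x,k)$ with $|k|>R$, the maps $M^1,M^2$ are well-defined $\mathbb C$-linear operators $S_R\to S_R$, and their operator norms satisfy $$\lim_{R\to\infty}\|M^1\|_{S_R}=0,\qquad \lim_{R\to\infty}\|M^2\|_{S_R}=0 .$$ -/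

import Mathlib

open MeasureTheory Filter Topology
open scoped ENNReal

noncomputable section

namespace Contractions

/-- Physical space `ℝ³` with the Euclidean norm; coordinates are numbered `0, 1, 2`. -/
abbrev E3 : Type := EuclideanSpace ℝ (Fin 3)

/-- The complex quaternions `ℂ ⊗ ℍ`: the elements `λ₀ + λ₁ e₁ + λ₂ e₂ + λ₃ e₃` with complex `λⱼ`,
`e₁² = e₂² = -1`, `e₁ e₂ = - e₂ e₁ = e₃`. The quaternionic conjugation is `star`
(it changes the signs of `λ₁, λ₂, λ₃` and does not conjugate the complex coefficients). -/
abbrev C2 : Type := Quaternion ℂ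

/-- The coefficient vector `(λ₀, λ₁, λ₂, λ₃)` of a complex quaternion. -/
def coeffs : C2 →ₗ[ℂ] EuclideanSpace ℂ (Fin 4) where
  toFun a := !₂[a.re, a.imI, a.imJ, a.imK]
  map_add' a b := by ext i; fin_cases i <;> simp
  map_smul' c a := by ext i; fin_cases i <;> simp

theorem coeffs_injective : Function.Injective coeffs := by
  intro a b h
  have h0 := congrArg (fun v : EuclideanSpace ℂ (Fin 4) => v 0) h
  have h1 := congrArg (fun v : EuclideanSpace ℂ (Fin 4) => v 1) h
  have h2 := congrArg (fun v : EuclideanSpace ℂ (Fin 4) => v 2) h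
  have h3 := congrArg (fun v : EuclideanSpace ℂ (Fin 4) => v 3) h
  simp [coeffs] at h0 h1 h2 h3
  ext <;> assumption

/-- The norm on `ℂ ⊗ ℍ` is the Euclidean norm of the coefficient vector. -/
instance : NormedAddCommGroup C2 :=
  NormedAddCommGroup.induced C2 (EuclideanSpace ℂ (Fin 4)) coeffs coeffs_injective

instance : NormedSpace ℂ C2 := NormedSpace.induced ℂ C2 (EuclideanSpace ℂ (Fin 4)) coeffs

instance : CompleteSpace C2 := FiniteDimensional.complete ℂ C2

theorem norm_C2 (a : C2) :
    ‖a‖ = Real.sqrt (‖a.re‖ ^ 2 + ‖a.imI‖ ^ 2 + ‖a.imJ‖ ^ 2 + ‖a.imK‖ ^ 2) := by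
  change ‖coeffs a‖ = _
  rw [EuclideanSpace.norm_eq]
  simp [coeffs, Fin.sum_univ_four]

/-- A point `x ∈ ℝ³` viewed as the quaternion `x₀ + x₁ e₁ + x₂ e₂`. -/
def toC2 (x : E3) : C2 := ⟨(x 0 : ℂ), (x 1 : ℂ), (x 2 : ℂ), 0⟩

/-- The kernel `-(1/4π) conj(y - x) / |y - x|³` of the Teodorescu operator `T`. -/
def kerT (x y : E3) : C2 :=
  (-(1 / (4 * (Real.pi : ℂ)))) • (((‖y - x‖ : ℂ) ^ 3)⁻¹ • star (toC2 (y - x)))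

/-- The kernel `-(1/4π) (y - x) / |y - x|³` of the conjugate operator `T̄`. -/
def kerTbar (x y : E3) : C2 :=
  (-(1 / (4 * (Real.pi : ℂ)))) • (((‖y - x‖ : ℂ) ^ 3)⁻¹ • toC2 (y - x))

/-- The singular integral `x ↦ ∫ K(x,y) g(y) dy` over `ℝ³` with a quaternionic kernel `K`
acting from the left. -/
def kerOp (K : E3 → E3 → C2) (g : E3 → C2) (x : E3) : C2 := ∫ y, K x y * g y

/-- Absolute convergence of the integral defining `kerOp K g x`. -/
def KerConverges (K : E3 → E3 → C2) (g : E3 → C2) (x : E3) : Prop :=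
  Integrable (fun y => K x y * g y)

/-- The oscillatory factor `e^{i x·k}`. -/
def osc (k x : E3) : ℂ := Complex.exp (Complex.I * (inner ℝ x k : ℂ))

/-- `y ↦ e^{-i y·k} g(y) q₁(y)`, the argument to which `T` is applied. -/
def argT (q₁ : E3 → C2) (k : E3) (g : E3 → C2) (y : E3) : C2 := osc (-k) y • (g y * q₁ y)

/-- `y ↦ e^{i y·k} g(y) q₂(y)`, the argument to which `T̄` is applied. -/
def argTbar (q₂ : E3 → C2) (k : E3) (g : E3 → C2) (y : E3) : C2 := osc k y • (g y * q₂ y)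

/-- `T[e^{-i y·k} f(y,k) q₁(y)](x)`. -/
def halfT (q₁ : E3 → C2) (f : E3 → E3 → C2) (x k : E3) : C2 :=
  kerOp kerT (argT q₁ k (fun y => f y k)) x

/-- `T̄[e^{i y·k} f(y,k) q₂(y)](x)`. -/
def halfTbar (q₂ : E3 → C2) (f : E3 → E3 → C2) (x k : E3) : C2 :=
  kerOp kerTbar (argTbar q₂ k (fun y => f y k)) x

/-- `M¹ f = T[e^{-i w·k} T̄[e^{i y·k} f q₂] q₁]`, as a function of `(x, k)`. -/
def M1 (q₁ q₂ : E3 → C2) (f : E3 → E3 → C2) : E3 → E3 → C2 := halfT q₁ (halfTbar q₂ f)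

/-- `M² f = T̄[e^{i w·k} T[e^{-i y·k} f q₁] q₂]`, as a function of `(x, k)`. -/
def M2 (q₁ q₂ : E3 → C2) (f : E3 → E3 → C2) : E3 → E3 → C2 := halfTbar q₂ (halfT q₁ f)

/-- Lebesgue measure on `{k ∈ ℝ³ : |k| > R}`. -/
def kMeasure (R : ℝ) : Measure E3 := volume.restrict {k : E3 | R < ‖k‖}

/-- Lebesgue measure on `{(x, k) ∈ ℝ³ × ℝ³ : |k| > R}`. -/
def xkMeasure (R : ℝ) : Measure (E3 × E3) := (volume : Measure E3).prod (kMeasure R)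

/-- The norm of `L^∞_x(L^p_k(|k| > R))`:
`ess sup_x (∫_{|k| > R} |f(x,k)|^p dk)^{1/p}`, with values in `[0, ∞]`. -/
def normS (p R : ℝ) (f : E3 → E3 → C2) : ℝ≥0∞ :=
  essSup (fun x => eLpNorm (f x) (ENNReal.ofReal p) (kMeasure R)) volume

/-- `f` represents an element of `S = L^∞_x(L^p_k(|k| > R))`; two functions represent the same
element iff they agree almost everywhere. -/
def MemS (p R : ℝ) (f : E3 → E3 → C2) : Prop :=
  AEStronglyMeasurable (fun z : E3 × E3 => f z.1 z.2) (xkMeasure R) ∧ normS p R f < ∞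

/-- Equality of `f` and `g` as elements of `S`. -/
def EqS (R : ℝ) (f g : E3 → E3 → C2) : Prop := ∀ᵐ z ∂(xkMeasure R), f z.1 z.2 = g z.1 z.2

/-- `M` is well defined as a `ℂ`-linear operator from `S` to `S`. -/
structure IsLinearOperatorOnS (p R : ℝ) (M : (E3 → E3 → C2) → (E3 → E3 → C2)) : Prop where
  mapsTo : ∀ f, MemS p R f → MemS p R (M f)
  congr : ∀ f g, MemS p R f → MemS p R g → EqS R f g → EqS R (M f) (M g)
  map_add : ∀ f g, MemS p R f → MemS p R g → EqS R (M (f + g)) (M f + M g)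
  map_smul : ∀ (c : ℂ) (f), MemS p R f → EqS R (M (c • f)) (c • M f)

/-- The operator norm on `S`, with values in `[0, ∞]`: the least constant `C` such that
`‖M f‖_S ≤ C ‖f‖_S` for every `f ∈ S` (and `∞` if `M` is not bounded on `S`). -/
def opNormS (p R : ℝ) (M : (E3 → E3 → C2) → (E3 → E3 → C2)) : ℝ≥0∞ :=
  sInf {C : ℝ≥0∞ | ∀ f, MemS p R f → normS p R (M f) ≤ C * normS p R f}

end Contractions

end

/-! Both operators are compositions of two maps of the form `half`: integration of `f` against a
kernel `κ (y - x)`, an exponential of modulus one and a potential `q`. With the exponential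
discarded, Schur's test (`lintegral_lintegral_mul_rpow_le`) bounds such a map on `S` by a constant
times the supremum over `x` of `∫ |κ (y - x)| |q y| dy`. This is finite because `|z|⁻²` is locally
integrable on `ℝ³` and `q` is bounded and integrable. Convergence, well-definedness and linearity
follow, but no smallness.

Smallness comes from the outer exponential. The inner exponential involves only the integration
variable `y` and `k`, so the inner function depends on its position `w` through the kernel alone.
Suppose the kernels are bounded and uniformly continuous and the outer potential is continuous with
compact support. Then, for almost every `k`, the non-oscillating factor of the outer integrand has a
modulus of continuity in `w` that depends on `k` only through the factor `Φ(k) = ∫ |q₂ y| |f(y,k)|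
dy`. A shift by half a period, of length `π/|k|`, as in the Riemann-Lebesgue lemma, bounds the outer
integral by a small multiple of `Φ(k)`, and Schur's test bounds `Φ` in `L^p_k`
(`exists_normS_half_half_le`).

The general case follows by approximation (`exists_normS_regKer_half_half_le`): capping the kernels
near the diagonal changes them little in `L¹`, and once the outer kernel is bounded the outer
potential may be replaced by an `L¹`-close one. Schur's test makes each error small uniformly in
`R`. The inner potential needs no approximation. -/

noncomputable section

namespace Contractions

/-! ### Multiplication of complex quaternions and the oscillatory factor -/

theorem C2_smul_mul (c : ℂ) (a b : C2) : (c • a) * b = c • (a * b) := by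
  ext <;> simp <;> ring

theorem C2_mul_smul (c : ℂ) (a b : C2) : a * (c • b) = c • (a * b) := by
  ext <;> simp <;> ring

/-- Multiplication of complex quaternions as a continuous bilinear map. -/
def mulL : C2 →L[ℂ] C2 →L[ℂ] C2 :=
  LinearMap.toContinuousLinearMap
    ((LinearMap.toContinuousLinearMap : (C2 →ₗ[ℂ] C2) ≃ₗ[ℂ] (C2 →L[ℂ] C2)).toLinearMap ∘ₗ
      LinearMap.mk₂ ℂ (fun a b : C2 => a * b) add_mul C2_smul_mul mul_add C2_mul_smul)

theorem mulL_apply (a b : C2) : mulL a b = a * b := rfl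

/-- A constant `C` with `‖a b‖ ≤ C ‖a‖ ‖b‖`. -/
def mulConst : NNReal := ‖mulL‖₊

theorem norm_mul_le_mulConst (a b : C2) : ‖a * b‖ ≤ mulConst * (‖a‖ * ‖b‖) := by
  have := mulL.le_opNorm₂ a b
  rw [mulL_apply, mul_assoc] at this
  exact this

theorem enorm_mul_le_mulConst (a b : C2) : ‖a * b‖ₑ ≤ mulConst * (‖a‖ₑ * ‖b‖ₑ) := by
  have : ‖a * b‖₊ ≤ mulConst * (‖a‖₊ * ‖b‖₊) := norm_mul_le_mulConst a b
  simp only [enorm_eq_nnnorm]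
  exact_mod_cast this

instance : ContinuousMul C2 where
  continuous_mul := by
    have : Continuous fun z : C2 × C2 => mulL z.1 z.2 := by fun_prop
    exact this

theorem norm_osc (k x : E3) : ‖osc k x‖ = 1 := by
  rw [osc, mul_comm, Complex.norm_exp_ofReal_mul_I]

theorem enorm_osc (k x : E3) : ‖osc k x‖ₑ = 1 := by
  rw [← ofReal_norm, norm_osc, ENNReal.ofReal_one]

theorem continuous_osc : Continuous fun z : E3 × E3 => osc z.1 z.2 := by
  unfold osc
  fun_prop

/-! ### One-step integral operators and Schur's test -/

/-- The integral over `y` of `κ (y - x) (e^{i y·u(k)} f(y, k) q(y))`. -/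
def half (κ : E3 → C2) (u : E3 → E3) (q : E3 → C2) (f : E3 → E3 → C2) (x k : E3) : C2 :=
  ∫ y, κ (y - x) * (osc (u k) y • (f y k * q y))

/-- Absolute convergence of the integral `half κ u q f x k`. -/
def HalfConverges (κ : E3 → C2) (u : E3 → E3) (q : E3 → C2) (f : E3 → E3 → C2) (x k : E3) :
    Prop :=
  Integrable fun y => κ (y - x) * (osc (u k) y • (f y k * q y))

/-- The weighted mass of the kernel `κ` against `q`, seen from `x`. -/
def mass (κ q : E3 → C2) (x : E3) : ℝ≥0∞ := ∫⁻ y, ‖κ (y - x)‖ₑ * ‖q y‖ₑ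

/-- The integral of the absolute values in `half`, up to the constant of multiplication. -/
def majorant (κ q : E3 → C2) (f : E3 → E3 → C2) (x k : E3) : ℝ≥0∞ :=
  ∫⁻ y, (‖κ (y - x)‖ₑ * ‖q y‖ₑ) * ‖f y k‖ₑ

theorem enorm_integrand_le (κ q : E3 → C2) (u : E3 → E3) (f : E3 → E3 → C2) (x k y : E3) :
    ‖κ (y - x) * (osc (u k) y • (f y k * q y))‖ₑ ≤
      (mulConst : ℝ≥0∞) ^ 2 * ((‖κ (y - x)‖ₑ * ‖q y‖ₑ) * ‖f y k‖ₑ) := by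
  refine (enorm_mul_le_mulConst _ _).trans ?_
  rw [enorm_smul, enorm_osc, one_mul]
  calc (mulConst : ℝ≥0∞) * (‖κ (y - x)‖ₑ * ‖f y k * q y‖ₑ)
      ≤ mulConst * (‖κ (y - x)‖ₑ * (mulConst * (‖f y k‖ₑ * ‖q y‖ₑ))) := by
        gcongr; exact enorm_mul_le_mulConst _ _
    _ = _ := by ring

theorem lintegral_integrand_le (κ q : E3 → C2) (u : E3 → E3) (f : E3 → E3 → C2) (x k : E3) :
    ∫⁻ y, ‖κ (y - x) * (osc (u k) y • (f y k * q y))‖ₑ ≤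
      (mulConst : ℝ≥0∞) ^ 2 * majorant κ q f x k := by
  rw [majorant, ← lintegral_const_mul' _ _ (by simp)]
  exact lintegral_mono fun y => enorm_integrand_le κ q u f x k y

theorem enorm_half_le (κ q : E3 → C2) (u : E3 → E3) (f : E3 → E3 → C2) (x k : E3) :
    ‖half κ u q f x k‖ₑ ≤ (mulConst : ℝ≥0∞) ^ 2 * majorant κ q f x k :=
  (enorm_integral_le_lintegral_enorm _).trans (lintegral_integrand_le κ q u f x k)

/-- Schur's test for averages of functions with values in `L^p`. -/
theorem lintegral_lintegral_mul_rpow_le {α β : Type*} [MeasurableSpace α] [MeasurableSpace β]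
    {μ : Measure α} {ν : Measure β} [SFinite μ] [SFinite ν] {p : ℝ} (hp : 1 < p)
    {w : α → ℝ≥0∞} (hw : Measurable w) {g : α → β → ℝ≥0∞} (hg : Measurable (Function.uncurry g))
    {N : ℝ≥0∞} (hN : ∀ᵐ y ∂μ, ∫⁻ k, g y k ^ p ∂ν ≤ N) :
    ∫⁻ k, (∫⁻ y, w y * g y k ∂μ) ^ p ∂ν ≤ (∫⁻ y, w y ∂μ) ^ p * N := by
  have hp0 : 0 < p := by linarith
  have hconj := Real.HolderConjugate.conjExponent hp
  set A := ∫⁻ y, w y ∂μ with hA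
  have hgk : ∀ k, Measurable fun y => g y k := fun k => hg.of_uncurry_right
  have key : ∀ k, (∫⁻ y, w y * g y k ∂μ) ^ p ≤ A ^ (p - 1) * ∫⁻ y, w y * g y k ^ p ∂μ := by
    intro k
    -- Hölder for the weighted measure `w dμ`, pairing `g` with the constant `1`; this is Jensen's
    -- inequality without normalising the weight.
    have h1 := ENNReal.lintegral_mul_le_Lp_mul_Lq (μ.withDensity w) hconj (hgk k).aemeasurable
      (g := fun _ => 1) aemeasurable_const
    simp only [Pi.mul_apply, mul_one, ENNReal.one_rpow] at h1
    rw [lintegral_withDensity_eq_lintegral_mul _ hw (hgk k),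
      lintegral_withDensity_eq_lintegral_mul _ hw ((hgk k).pow_const p),
      lintegral_withDensity_eq_lintegral_mul _ hw measurable_const] at h1
    simp only [Pi.mul_apply, mul_one] at h1
    calc (∫⁻ y, w y * g y k ∂μ) ^ p
        ≤ ((∫⁻ y, w y * g y k ^ p ∂μ) ^ (1 / p) * A ^ (1 / p.conjExponent)) ^ p := by gcongr
      _ = _ := by
        rw [ENNReal.mul_rpow_of_nonneg _ _ hp0.le, ← ENNReal.rpow_mul, ← ENNReal.rpow_mul,
          one_div_mul_cancel hp0.ne', ENNReal.rpow_one, mul_comm]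
        congr 2
        rw [Real.conjExponent]
        field_simp
  calc ∫⁻ k, (∫⁻ y, w y * g y k ∂μ) ^ p ∂ν
      ≤ ∫⁻ k, A ^ (p - 1) * ∫⁻ y, w y * g y k ^ p ∂μ ∂ν := lintegral_mono key
    _ = A ^ (p - 1) * ∫⁻ k, ∫⁻ y, w y * g y k ^ p ∂μ ∂ν := by
        refine lintegral_const_mul _ ?_
        exact Measurable.lintegral_prod_left'
          (f := fun z : α × β => w z.1 * g z.1 z.2 ^ p)
          ((hw.comp measurable_fst).mul (hg.pow_const p))
    _ = A ^ (p - 1) * ∫⁻ y, ∫⁻ k, w y * g y k ^ p ∂ν ∂μ := by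
        rw [lintegral_lintegral_swap]
        exact (((hw.comp measurable_snd).mul
          ((hg.comp measurable_swap).pow_const p))).aemeasurable
    _ = A ^ (p - 1) * ∫⁻ y, w y * ∫⁻ k, g y k ^ p ∂ν ∂μ := by
        congr 1
        refine lintegral_congr fun y => lintegral_const_mul _ ?_
        exact hg.of_uncurry_left.pow_const p
    _ ≤ A ^ (p - 1) * ∫⁻ y, w y * N ∂μ := by
        gcongr 1
        exact lintegral_mono_ae (hN.mono fun y hy => by gcongr)
    _ = A ^ p * N := by
        -- `A ^ (p - 1) * A = A ^ p` also when `A` is `0` or `∞`, since both exponents are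
        -- nonnegative.
        rw [lintegral_mul_const _ hw, ← mul_assoc, ← hA]
        congr 1
        conv_lhs => rw [← ENNReal.rpow_one A, ← ENNReal.rpow_mul, mul_comm]
        rw [one_mul, ← ENNReal.rpow_add_of_nonneg _ _ (by norm_num) (by linarith)]
        congr 1; ring

/-! ### Classes modulo almost everywhere equality -/

instance (R : ℝ) : SFinite (kMeasure R) := by unfold kMeasure; infer_instance

theorem ae_ae_of_ae_xkMeasure {R : ℝ} {P : E3 × E3 → Prop} (h : ∀ᵐ z ∂(xkMeasure R), P z) :
    ∀ᵐ k ∂(kMeasure R), ∀ᵐ x, P (x, k) :=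
  Measure.ae_ae_of_ae_prod
    (Measure.measurePreserving_swap.quasiMeasurePreserving.ae h :
      ∀ᵐ z ∂((kMeasure R).prod volume), P z.swap)

theorem ae_xkMeasure_of_ae {R : ℝ} {P : E3 × E3 → Prop}
    (h : ∀ᵐ k ∂(kMeasure R), ∀ x, P (x, k)) : ∀ᵐ z ∂(xkMeasure R), P z :=
  (Measure.quasiMeasurePreserving_snd.ae h).mono fun z hz => hz z.1

theorem EqS.symm {R : ℝ} {f g : E3 → E3 → C2} (h : EqS R f g) : EqS R g f :=
  Filter.Eventually.mono h fun _ hz => hz.symm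

theorem EqS.trans {R : ℝ} {f g h : E3 → E3 → C2} (hfg : EqS R f g) (hgh : EqS R g h) :
    EqS R f h := by
  filter_upwards [hfg, hgh] with z h1 h2 using h1.trans h2

theorem normS_congr {p R : ℝ} {f g : E3 → E3 → C2} (h : EqS R f g) :
    normS p R f = normS p R g := by
  refine essSup_congr_ae ?_
  filter_upwards [Measure.ae_ae_of_ae_prod h] with x hx using eLpNorm_congr_ae hx

theorem MemS.congr {p R : ℝ} {f g : E3 → E3 → C2} (hf : MemS p R f) (h : EqS R f g) :
    MemS p R g :=
  ⟨AEStronglyMeasurable.congr hf.1 h, normS_congr (p := p) h ▸ hf.2⟩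

theorem normS_add_le {p R : ℝ} (hp : 1 ≤ p) {f g : E3 → E3 → C2} (hf : MemS p R f)
    (hg : MemS p R g) : normS p R (f + g) ≤ normS p R f + normS p R g := by
  refine essSup_le_of_ae_le _ ?_
  filter_upwards [hf.1.prodMk_left, hg.1.prodMk_left,
    ae_le_essSup (f := fun x => eLpNorm (f x) (ENNReal.ofReal p) (kMeasure R)),
    ae_le_essSup (f := fun x => eLpNorm (g x) (ENNReal.ofReal p) (kMeasure R))] with x h1 h2 h3 h4
  exact (eLpNorm_add_le h1 h2 (by simpa using hp)).trans (add_le_add h3 h4)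

theorem normS_smul {p R : ℝ} (c : ℂ) (f : E3 → E3 → C2) :
    normS p R (c • f) = ‖c‖ₑ * normS p R f := by
  rw [normS, normS, ← ENNReal.essSup_const_mul]
  congr 1
  ext x
  exact eLpNorm_const_smul c (f x) _ _

theorem MemS.add {p R : ℝ} (hp : 1 ≤ p) {f g : E3 → E3 → C2} (hf : MemS p R f)
    (hg : MemS p R g) : MemS p R (f + g) :=
  ⟨hf.1.add hg.1, (normS_add_le hp hf hg).trans_lt (ENNReal.add_lt_top.2 ⟨hf.2, hg.2⟩)⟩

theorem MemS.smul {p R : ℝ} (c : ℂ) {f : E3 → E3 → C2} (hf : MemS p R f) :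
    MemS p R (c • f) :=
  ⟨hf.1.const_smul c, by rw [normS_smul]; exact ENNReal.mul_lt_top (by simp) hf.2⟩

/-- Every measurable function on `ℝ³ × {|k| > R}` has a jointly strongly measurable version. -/
theorem exists_stronglyMeasurable_eqS {R : ℝ} {f : E3 → E3 → C2}
    (hf : AEStronglyMeasurable (fun z : E3 × E3 => f z.1 z.2) (xkMeasure R)) :
    ∃ g : E3 → E3 → C2, StronglyMeasurable (Function.uncurry g) ∧ EqS R f g :=
  ⟨fun x k => hf.mk _ (x, k), hf.stronglyMeasurable_mk, hf.ae_eq_mk⟩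

section Congr

variable {κ q : E3 → C2} {u : E3 → E3} {R : ℝ} {f g : E3 → E3 → C2}

/-- For almost every `k` the two functions agree for almost every `y`, and this exceptional set of
`k` does not involve `x`. Hence the agreement at every `x`. -/
theorem ae_half_eq (h : EqS R f g) :
    ∀ᵐ k ∂(kMeasure R), ∀ x, half κ u q f x k = half κ u q g x k := by
  filter_upwards [ae_ae_of_ae_xkMeasure h] with k hk x
  exact integral_congr_ae (hk.mono fun y hy => by simp only at hy ⊢; rw [hy])

theorem half_eqS (h : EqS R f g) : EqS R (half κ u q f) (half κ u q g) :=
  ae_xkMeasure_of_ae (ae_half_eq h)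

theorem ae_majorant_eq (h : EqS R f g) :
    ∀ᵐ k ∂(kMeasure R), ∀ x, majorant κ q f x k = majorant κ q g x k := by
  filter_upwards [ae_ae_of_ae_xkMeasure h] with k hk x
  exact lintegral_congr_ae (hk.mono fun y hy => by simp only at hy ⊢; rw [hy])

theorem ae_halfConverges_iff (h : EqS R f g) :
    ∀ᵐ k ∂(kMeasure R), ∀ x, HalfConverges κ u q f x k ↔ HalfConverges κ u q g x k := by
  filter_upwards [ae_ae_of_ae_xkMeasure h] with k hk x
  exact integrable_congr (hk.mono fun y hy => by simp only at hy ⊢; rw [hy])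

end Congr

/-! ### Boundedness, measurability and absolute convergence -/

theorem ae_lintegral_rpow_le_normS {p R : ℝ} (hp : 0 < p) (f : E3 → E3 → C2) :
    ∀ᵐ y, ∫⁻ k, ‖f y k‖ₑ ^ p ∂(kMeasure R) ≤ normS p R f ^ p := by
  filter_upwards [ae_le_essSup (f := fun x => eLpNorm (f x) (ENNReal.ofReal p) (kMeasure R))]
    with y hy
  rw [eLpNorm_eq_lintegral_rpow_enorm_toReal (by simpa using hp) (by simp),
    ENNReal.toReal_ofReal hp.le, one_div, ENNReal.rpow_inv_le_iff hp] at hy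
  exact hy

theorem lintegral_majorant_rpow_le {p R : ℝ} (hp : 1 < p) {κ q : E3 → C2}
    (hκ : StronglyMeasurable κ) (hq : StronglyMeasurable q) {f : E3 → E3 → C2}
    (hf : AEStronglyMeasurable (fun z : E3 × E3 => f z.1 z.2) (xkMeasure R)) (x : E3) :
    ∫⁻ k, majorant κ q f x k ^ p ∂(kMeasure R) ≤ mass κ q x ^ p * normS p R f ^ p := by
  obtain ⟨g, hg, hfg⟩ := exists_stronglyMeasurable_eqS hf
  rw [normS_congr hfg, lintegral_congr_ae ((ae_majorant_eq (κ := κ) (q := q) hfg).mono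
    fun k hk => by simp only [hk x]; rfl)]
  refine lintegral_lintegral_mul_rpow_le hp ?_ (g := fun y k => ‖g y k‖ₑ) hg.enorm
    (ae_lintegral_rpow_le_normS (by linarith) g)
  exact (hκ.enorm.comp (measurable_id.sub_const x)).mul hq.enorm

/-- Stated for any `g` dominated by a majorant, so that it serves both the crude bound on `half` and
the final oscillatory estimate. -/
theorem eLpNorm_le_mass_mul_normS {p R : ℝ} (hp : 1 < p) {κ q : E3 → C2}
    (hκ : StronglyMeasurable κ) (hq : StronglyMeasurable q) {f : E3 → E3 → C2}
    (hf : AEStronglyMeasurable (fun z : E3 × E3 => f z.1 z.2) (xkMeasure R)) (x : E3)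
    {g : E3 → C2} {D : ℝ≥0∞} (hD : D ≠ ∞)
    (hg : ∀ᵐ k ∂(kMeasure R), ‖g k‖ₑ ≤ D * majorant κ q f x k) :
    eLpNorm g (ENNReal.ofReal p) (kMeasure R) ≤ D * mass κ q x * normS p R f := by
  have hp0 : 0 < p := by linarith
  rw [eLpNorm_eq_lintegral_rpow_enorm_toReal (by simpa using hp0) (by simp),
    ENNReal.toReal_ofReal hp0.le, one_div, ENNReal.rpow_inv_le_iff hp0,
    ENNReal.mul_rpow_of_nonneg _ _ hp0.le, ENNReal.mul_rpow_of_nonneg _ _ hp0.le, mul_assoc]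
  calc ∫⁻ k, ‖g k‖ₑ ^ p ∂(kMeasure R)
      ≤ ∫⁻ k, D ^ p * majorant κ q f x k ^ p ∂(kMeasure R) := by
        refine lintegral_mono_ae (hg.mono fun k hk => ?_)
        rw [← ENNReal.mul_rpow_of_nonneg _ _ hp0.le]
        gcongr
    _ ≤ _ := by
        rw [lintegral_const_mul' _ _ (ENNReal.rpow_ne_top_of_nonneg hp0.le hD)]
        gcongr
        exact lintegral_majorant_rpow_le hp hκ hq hf x

/-- Pairs `κ, q` to which Schur's test applies. -/
structure Admissible (κ q : E3 → C2) : Prop where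
  ker : StronglyMeasurable κ
  pot : StronglyMeasurable q
  bound : ∃ A : ℝ≥0∞, A ≠ ∞ ∧ ∀ x, mass κ q x ≤ A

theorem eLpNorm_half_le {p R : ℝ} (hp : 1 < p) {κ q : E3 → C2} (u : E3 → E3)
    (hκ : StronglyMeasurable κ) (hq : StronglyMeasurable q) {f : E3 → E3 → C2}
    (hf : AEStronglyMeasurable (fun z : E3 × E3 => f z.1 z.2) (xkMeasure R)) (x : E3) :
    eLpNorm (half κ u q f x) (ENNReal.ofReal p) (kMeasure R) ≤
      (mulConst : ℝ≥0∞) ^ 2 * mass κ q x * normS p R f :=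
  eLpNorm_le_mass_mul_normS hp hκ hq hf x (by simp)
    (Eventually.of_forall fun k => enorm_half_le κ q u f x k)

theorem normS_half_le {p R : ℝ} (hp : 1 < p) {κ q : E3 → C2} (u : E3 → E3)
    (hκ : StronglyMeasurable κ) (hq : StronglyMeasurable q) {f : E3 → E3 → C2}
    (hf : AEStronglyMeasurable (fun z : E3 × E3 => f z.1 z.2) (xkMeasure R))
    {A : ℝ≥0∞} (hA : ∀ x, mass κ q x ≤ A) :
    normS p R (half κ u q f) ≤ (mulConst : ℝ≥0∞) ^ 2 * A * normS p R f := by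
  refine essSup_le_of_ae_le _ (Eventually.of_forall fun x => ?_)
  exact (eLpNorm_half_le hp u hκ hq hf x).trans
    (mul_le_mul' (mul_le_mul' le_rfl (hA x)) le_rfl)

theorem stronglyMeasurable_integrand {κ q : E3 → C2} {u : E3 → E3} (hu : Continuous u)
    (hκ : StronglyMeasurable κ) (hq : StronglyMeasurable q) {f : E3 → E3 → C2}
    (hf : StronglyMeasurable (Function.uncurry f)) :
    StronglyMeasurable fun w : (E3 × E3) × E3 =>
      κ (w.2 - w.1.1) * (osc (u w.1.2) w.2 • (f w.2 w.1.2 * q w.2)) := by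
  have h1 : StronglyMeasurable fun w : (E3 × E3) × E3 => κ (w.2 - w.1.1) :=
    hκ.comp_measurable (by fun_prop)
  have h2 : StronglyMeasurable fun w : (E3 × E3) × E3 => osc (u w.1.2) w.2 :=
    (continuous_osc.comp (by fun_prop :
      Continuous fun w : (E3 × E3) × E3 => (u w.1.2, w.2))).stronglyMeasurable
  have h3 : StronglyMeasurable fun w : (E3 × E3) × E3 => f w.2 w.1.2 :=
    hf.comp_measurable (by fun_prop : Measurable fun w : (E3 × E3) × E3 => (w.2, w.1.2))
  have h4 : StronglyMeasurable fun w : (E3 × E3) × E3 => q w.2 :=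
    hq.comp_measurable measurable_snd
  exact h1.mul (h2.smul (h3.mul h4))

theorem aestronglyMeasurable_half {R : ℝ} {κ q : E3 → C2} {u : E3 → E3} (hu : Continuous u)
    (hκ : StronglyMeasurable κ) (hq : StronglyMeasurable q) {f : E3 → E3 → C2}
    (hf : AEStronglyMeasurable (fun z : E3 × E3 => f z.1 z.2) (xkMeasure R)) :
    AEStronglyMeasurable (fun z : E3 × E3 => half κ u q f z.1 z.2) (xkMeasure R) := by
  obtain ⟨g, hg, hfg⟩ := exists_stronglyMeasurable_eqS hf
  have := (stronglyMeasurable_integrand hu hκ hq hg).integral_prod_right' (ν := volume)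
  exact AEStronglyMeasurable.congr this.aestronglyMeasurable (half_eqS hfg.symm)

theorem MemS.half {p R : ℝ} (hp : 1 < p) {κ q : E3 → C2} {u : E3 → E3} (hu : Continuous u)
    (h : Admissible κ q) {f : E3 → E3 → C2} (hf : MemS p R f) :
    MemS p R (half κ u q f) := by
  obtain ⟨A, hA, hm⟩ := h.bound
  refine ⟨aestronglyMeasurable_half hu h.ker h.pot hf.1, ?_⟩
  refine (normS_half_le hp u h.ker h.pot hf.1 hm).trans_lt ?_
  exact ENNReal.mul_lt_top (ENNReal.mul_lt_top (by simp) hA.lt_top) hf.2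

theorem measurable_majorant {κ q : E3 → C2} (hκ : StronglyMeasurable κ)
    (hq : StronglyMeasurable q) {f : E3 → E3 → C2}
    (hf : StronglyMeasurable (Function.uncurry f)) :
    Measurable fun z : E3 × E3 => majorant κ q f z.1 z.2 := by
  have h1 : Measurable fun w : (E3 × E3) × E3 => ‖κ (w.2 - w.1.1)‖ₑ :=
    (hκ.comp_measurable (by fun_prop)).enorm
  have h2 : Measurable fun w : (E3 × E3) × E3 => ‖q w.2‖ₑ :=
    (hq.comp_measurable measurable_snd).enorm
  have h3 : Measurable fun w : (E3 × E3) × E3 => ‖f w.2 w.1.2‖ₑ :=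
    (hf.comp_measurable
      (by fun_prop : Measurable fun w : (E3 × E3) × E3 => (w.2, w.1.2))).enorm
  exact ((h1.mul h2).mul h3).lintegral_prod_right' (ν := volume)

theorem ae_majorant_lt_top {p R : ℝ} (hp : 1 < p) {κ q : E3 → C2} (h : Admissible κ q)
    {f : E3 → E3 → C2} (hf : MemS p R f) (x : E3) :
    ∀ᵐ k ∂(kMeasure R), majorant κ q f x k < ∞ := by
  have hp0 : 0 < p := by linarith
  obtain ⟨A, hA, hm⟩ := h.bound
  obtain ⟨g, hg, hfg⟩ := exists_stronglyMeasurable_eqS hf.1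
  have hgS := hf.congr hfg
  have h1 := lintegral_majorant_rpow_le hp h.ker h.pot hgS.1 x
  have h2 : mass κ q x ^ p * normS p R g ^ p < ∞ := ENNReal.mul_lt_top
    (ENNReal.rpow_lt_top_of_nonneg hp0.le ((hm x).trans_lt hA.lt_top).ne)
    (ENNReal.rpow_lt_top_of_nonneg hp0.le hgS.2.ne)
  have hmeas : Measurable fun k => majorant κ q g x k :=
    Measurable.of_uncurry_left (f := majorant κ q g) (measurable_majorant h.ker h.pot hg)
  have hlt : ∀ᵐ k ∂(kMeasure R), majorant κ q g x k ^ p < ∞ :=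
    ae_lt_top (hmeas.pow_const p) (h1.trans_lt h2).ne
  have heq : ∀ᵐ k ∂(kMeasure R), ∀ x, majorant κ q f x k = majorant κ q g x k :=
    ae_majorant_eq hfg
  refine (hlt.and heq).mono fun k hk => ?_
  rw [hk.2 x]
  exact (ENNReal.rpow_lt_top_iff_of_pos hp0).1 hk.1

theorem halfConverges_of_majorant_lt_top {κ q : E3 → C2} {u : E3 → E3} (hu : Continuous u)
    (hκ : StronglyMeasurable κ) (hq : StronglyMeasurable q) {f : E3 → E3 → C2}
    (hf : StronglyMeasurable (Function.uncurry f)) {x k : E3} (h : majorant κ q f x k < ∞) :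
    HalfConverges κ u q f x k :=
  ⟨((stronglyMeasurable_integrand hu hκ hq hf).comp_measurable
    (measurable_prodMk_left (x := (x, k)))).aestronglyMeasurable,
    (lintegral_integrand_le κ q u f x k).trans_lt (ENNReal.mul_lt_top (by simp) h)⟩

theorem ae_halfConverges {p R : ℝ} (hp : 1 < p) {κ q : E3 → C2} {u : E3 → E3}
    (hu : Continuous u) (h : Admissible κ q) {f : E3 → E3 → C2} (hf : MemS p R f) :
    ∀ᵐ z ∂(xkMeasure R), HalfConverges κ u q f z.1 z.2 := by
  obtain ⟨g, hg, hfg⟩ := exists_stronglyMeasurable_eqS hf.1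
  have hgS := hf.congr hfg
  -- Passing from "every `x`, almost every `k`" to almost every pair needs a measurable set, hence
  -- the jointly measurable version `g`.
  have hmeas : MeasurableSet {z : E3 × E3 | majorant κ q g z.1 z.2 < ∞} :=
    measurableSet_lt (measurable_majorant h.ker h.pot hg) measurable_const
  have hfin : ∀ᵐ z ∂(xkMeasure R), majorant κ q g z.1 z.2 < ∞ :=
    (Measure.ae_prod_iff_ae_ae hmeas).2
      (Eventually.of_forall fun x => ae_majorant_lt_top hp h hgS x)
  filter_upwards [hfin, ae_xkMeasure_of_ae (P := fun z => HalfConverges κ u q f z.1 z.2 ↔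
    HalfConverges κ u q g z.1 z.2) (ae_halfConverges_iff hfg)] with z hz hz'
  rw [hz']
  exact halfConverges_of_majorant_lt_top hu h.ker h.pot hg hz

/-! ### Linearity in the function, the kernel and the potential -/

section Linear

variable {p R : ℝ} {κ q κ' q' : E3 → C2} {u : E3 → E3} {f g : E3 → E3 → C2}

theorem half_add (hp : 1 < p) (hu : Continuous u) (h : Admissible κ q) (hf : MemS p R f)
    (hg : MemS p R g) : EqS R (half κ u q (f + g)) (half κ u q f + half κ u q g) := by
  filter_upwards [ae_halfConverges hp hu h hf, ae_halfConverges hp hu h hg] with z h1 h2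
  simp only [Pi.add_apply, half]
  rw [← integral_add h1 h2]
  simp only [add_mul, smul_add, mul_add]

theorem half_smul (c : ℂ) : half κ u q (c • f) = c • half κ u q f := by
  ext1 x
  ext1 k
  simp only [Pi.smul_apply, half]
  rw [← integral_smul]
  simp only [C2_smul_mul, C2_mul_smul, smul_comm c]

theorem half_add_ker (hp : 1 < p) (hu : Continuous u) (h : Admissible κ q)
    (h' : Admissible κ' q) (hf : MemS p R f) :
    EqS R (half (κ + κ') u q f) (half κ u q f + half κ' u q f) := by
  filter_upwards [ae_halfConverges hp hu h hf, ae_halfConverges hp hu h' hf] with z h1 h2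
  simp only [Pi.add_apply, half]
  rw [← integral_add h1 h2]
  simp only [add_mul]

theorem half_add_pot (hp : 1 < p) (hu : Continuous u) (h : Admissible κ q)
    (h' : Admissible κ q') (hf : MemS p R f) :
    EqS R (half κ u (q + q') f) (half κ u q f + half κ u q' f) := by
  filter_upwards [ae_halfConverges hp hu h hf, ae_halfConverges hp hu h' hf] with z h1 h2
  simp only [Pi.add_apply, half]
  rw [← integral_add h1 h2]
  simp only [mul_add, smul_add]

theorem isLinearOperatorOnS_half (hp : 1 < p) (hu : Continuous u) (h : Admissible κ q) :
    IsLinearOperatorOnS p R (half κ u q) where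
  mapsTo _ hf := hf.half hp hu h
  congr _ _ _ _ hfg := half_eqS hfg
  map_add _ _ hf hg := half_add hp hu h hf hg
  map_smul c _ _ := by
    rw [half_smul]
    exact Eventually.of_forall fun _ => rfl

/-- Linearity of the inner map holds only modulo null sets, so `congr` of the outer map is needed to
carry it through. -/
theorem IsLinearOperatorOnS.comp {M M' : (E3 → E3 → C2) → (E3 → E3 → C2)} (hp : 1 ≤ p)
    (hM : IsLinearOperatorOnS p R M) (hM' : IsLinearOperatorOnS p R M') :
    IsLinearOperatorOnS p R (fun f => M (M' f)) where
  mapsTo f hf := hM.mapsTo _ (hM'.mapsTo f hf)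
  congr f g hf hg h := hM.congr _ _ (hM'.mapsTo f hf) (hM'.mapsTo g hg) (hM'.congr f g hf hg h)
  map_add f g hf hg :=
    (hM.congr _ _ (hM'.mapsTo _ (hf.add hp hg)) ((hM'.mapsTo f hf).add hp (hM'.mapsTo g hg))
      (hM'.map_add f g hf hg)).trans (hM.map_add _ _ (hM'.mapsTo f hf) (hM'.mapsTo g hg))
  map_smul c f hf :=
    (hM.congr _ _ (hM'.mapsTo _ (hf.smul c)) ((hM'.mapsTo f hf).smul c)
      (hM'.map_smul c f hf)).trans (hM.map_smul c _ (hM'.mapsTo f hf))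

end Linear

/-! ### Regularised kernels -/

/-- The kernel `-(1/4π) s(z) / max(|z|, δ)³`, a regularisation of `-(1/4π) s(z) / |z|³`. -/
def regKer (s : E3 → C2) (δ : ℝ) (z : E3) : C2 :=
  (-(1 / (4 * (Real.pi : ℂ)))) • ((((max ‖z‖ δ : ℝ) : ℂ) ^ 3)⁻¹ • s z)

section Kernel

variable {s : E3 → C2} {δ : ℝ}

theorem norm_regKer_le (hs : ∀ z, ‖s z‖ = ‖z‖) (hδ : 0 ≤ δ) (z : E3) :
    ‖regKer s δ z‖ ≤ (max ‖z‖ δ ^ 2)⁻¹ := by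
  have hm : 0 ≤ max ‖z‖ δ := le_max_of_le_right hδ
  have hc : ‖(-(1 / (4 * (Real.pi : ℂ))) : ℂ)‖ ≤ 1 := by
    rw [norm_neg, norm_div, norm_one, norm_mul, Complex.norm_real, Real.norm_eq_abs,
      abs_of_pos Real.pi_pos]
    have := Real.pi_gt_three
    rw [Complex.norm_ofNat, div_le_one (by positivity)]
    linarith
  rw [regKer, norm_smul, norm_smul, norm_inv, norm_pow, Complex.norm_real, Real.norm_eq_abs,
    abs_of_nonneg hm, hs]
  -- If the maximum is `0`, both sides vanish by the convention `0⁻¹ = 0`.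
  rcases hm.eq_or_lt with h0 | h0
  · simp [← h0]
  calc _ ≤ 1 * ((max ‖z‖ δ ^ 3)⁻¹ * max ‖z‖ δ) := by
        gcongr
        exact le_max_left _ _
    _ = _ := by field_simp

theorem norm_regKer_le_inv_norm_sq (hs : ∀ z, ‖s z‖ = ‖z‖) (hδ : 0 ≤ δ) (z : E3) :
    ‖regKer s δ z‖ ≤ (‖z‖ ^ 2)⁻¹ := by
  rcases (norm_nonneg z).eq_or_lt with h0 | h0
  · have : s z = 0 := by rw [← norm_eq_zero, hs, h0]
    rw [regKer, this, smul_zero, smul_zero, norm_zero]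
    positivity
  · refine (norm_regKer_le hs hδ z).trans ?_
    gcongr
    exact le_max_left _ _

theorem norm_regKer_le_const (hs : ∀ z, ‖s z‖ = ‖z‖) (hδ : 0 < δ) (z : E3) :
    ‖regKer s δ z‖ ≤ (δ ^ 2)⁻¹ := by
  refine (norm_regKer_le hs hδ.le z).trans ?_
  gcongr
  exact le_max_right _ _

theorem regKer_eq_of_le {z : E3} (h : δ ≤ ‖z‖) : regKer s 0 z = regKer s δ z := by
  rw [regKer, regKer, max_eq_left h, max_eq_left (norm_nonneg z)]

theorem stronglyMeasurable_regKer (hs : Continuous s) : StronglyMeasurable (regKer s δ) := by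
  have h1 : Measurable fun z : E3 => (((max ‖z‖ δ : ℝ) : ℂ) ^ 3)⁻¹ := by fun_prop
  have h2 := h1.stronglyMeasurable.smul hs.stronglyMeasurable
  exact h2.const_smul (-(1 / (4 * (Real.pi : ℂ))))

theorem continuous_regKer (hs : Continuous s) (hδ : 0 < δ) : Continuous (regKer s δ) := by
  have h1 : Continuous fun z : E3 => (((max ‖z‖ δ : ℝ) : ℂ) ^ 3)⁻¹ := by
    refine Continuous.inv₀ (by fun_prop) fun z => ?_
    have : 0 < max ‖z‖ δ := lt_max_of_lt_right hδ
    exact_mod_cast (by positivity : max ‖z‖ δ ^ 3 ≠ 0)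
  exact (h1.smul hs).const_smul (-(1 / (4 * (Real.pi : ℂ))))

/-- A continuous function tending to zero at infinity is uniformly continuous. -/
theorem uniformContinuous_regKer (hs : Continuous s) (hs' : ∀ z, ‖s z‖ = ‖z‖) (hδ : 0 < δ) :
    UniformContinuous (regKer s δ) := by
  refine (continuous_regKer hs hδ).uniformContinuous_of_tendsto_cocompact (x := 0) ?_
  rw [tendsto_zero_iff_norm_tendsto_zero]
  have h1 : Tendsto (fun z : E3 => (‖z‖ ^ 2)⁻¹) (cocompact E3) (𝓝 0) :=
    tendsto_inv_atTop_zero.comp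
      ((tendsto_pow_atTop two_ne_zero).comp (tendsto_norm_cocompact_atTop (E := E3)))
  refine squeeze_zero' (Eventually.of_forall fun _ => norm_nonneg _) ?_ h1
  exact Eventually.of_forall fun z => norm_regKer_le_inv_norm_sq hs' hδ.le z

theorem integrableOn_inv_norm_sq :
    IntegrableOn (fun z : E3 => (‖z‖ ^ 2)⁻¹) (Metric.ball 0 1) := by
  -- In polar coordinates the Jacobian `r²` cancels `r⁻²`, leaving the constant `1` on `(0, 1)`.
  have h := (integrable_fun_norm_addHaar (volume : Measure E3)
    (f := (Set.Iio (1 : ℝ)).indicator fun r => (r ^ 2)⁻¹)).2 (by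
      have hfin : Module.finrank ℝ E3 = 3 := by simp
      rw [hfin]
      have : IntegrableOn (fun _ : ℝ => (1 : ℝ)) (Set.Ioo 0 1) := by
        refine integrableOn_const ?_
        simp
      have h2 := (integrable_indicator_iff measurableSet_Ioo).2 this
      refine (h2.integrableOn (s := Set.Ioi 0)).congr_fun (fun r hr => ?_) measurableSet_Ioi
      have hr0 : (0 : ℝ) < r := hr
      by_cases h1 : r < 1
      · rw [Set.indicator_of_mem (Set.mem_Ioo.2 ⟨hr0, h1⟩)]
        simp only [smul_eq_mul]
        rw [Set.indicator_of_mem (Set.mem_Iio.2 h1)]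
        have : r ≠ 0 := hr0.ne'
        field_simp
      · rw [Set.indicator_of_notMem (fun h => h1 h.2)]
        simp only [smul_eq_mul]
        rw [Set.indicator_of_notMem (s := Set.Iio (1 : ℝ)) (fun h => h1 h), mul_zero])
  rw [← integrable_indicator_iff Metric.isOpen_ball.measurableSet]
  refine h.congr (Eventually.of_forall fun z => ?_)
  by_cases h1 : ‖z‖ < 1
  · simp [Set.indicator, h1]
  · simp [Set.indicator, h1]

theorem enorm_regKer_sub_le (hs : ∀ z, ‖s z‖ = ‖z‖) (hδ : 0 ≤ δ) (z : E3) :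
    ‖(regKer s 0 - regKer s δ) z‖ₑ ≤
      (Metric.ball (0 : E3) δ).indicator (fun z => 2 * ‖(‖z‖ ^ 2)⁻¹‖ₑ) z := by
  rw [Pi.sub_apply]
  by_cases h : δ ≤ ‖z‖
  · simp [regKer_eq_of_le h]
  have hz : z ∈ Metric.ball (0 : E3) δ := by simpa using h
  rw [Set.indicator_of_mem hz, two_mul]
  have key : ∀ r : ℝ, 0 ≤ r → ‖regKer s r z‖ₑ ≤ ‖(‖z‖ ^ 2)⁻¹‖ₑ := fun r hr => by
    rw [← ofReal_norm, ← ofReal_norm]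
    exact ENNReal.ofReal_le_ofReal
      ((norm_regKer_le_inv_norm_sq hs hr z).trans (Real.le_norm_self _))
  exact enorm_sub_le.trans (add_le_add (key 0 le_rfl) (key δ hδ))

/-- The difference lives in the ball of radius `δ` and is dominated there by `2|z|⁻²`. Absolute
continuity of the integral makes it small, since the volume of the ball tends to zero. -/
theorem exists_lintegral_regKer_sub_le (hs : ∀ z, ‖s z‖ = ‖z‖) {η : ℝ≥0∞} (hη : 0 < η) :
    ∃ δ : ℝ, 0 < δ ∧ ∫⁻ z, ‖(regKer s 0 - regKer s δ) z‖ₑ ≤ η := by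
  set g : E3 → ℝ≥0∞ := (Metric.ball (0 : E3) 1).indicator fun z => 2 * ‖(‖z‖ ^ 2)⁻¹‖ₑ with hg
  have hfin : ∫⁻ z, g z ≠ ∞ := by
    rw [hg, lintegral_indicator Metric.isOpen_ball.measurableSet,
      lintegral_const_mul' _ _ (by simp)]
    exact ENNReal.mul_ne_top (by simp) integrableOn_inv_norm_sq.2.ne
  have hvol : Tendsto (volume ∘ fun δ : ℝ => Metric.ball (0 : E3) δ) (𝓝[>] 0) (𝓝 0) := by
    have h1 : Tendsto (fun δ : ℝ => ENNReal.ofReal δ ^ 3 * volume (Metric.ball (0 : E3) 1))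
        (𝓝 0) (𝓝 (ENNReal.ofReal 0 ^ 3 * volume (Metric.ball (0 : E3) 1))) :=
      ENNReal.Tendsto.mul_const
        ((ENNReal.continuous_pow 3).tendsto _ |>.comp (ENNReal.tendsto_ofReal tendsto_id))
        (Or.inr measure_ball_lt_top.ne)
    simp only [ENNReal.ofReal_zero, ne_eq, OfNat.ofNat_ne_zero, not_false_eq_true, zero_pow,
      zero_mul] at h1
    refine (h1.mono_left nhdsWithin_le_nhds).congr' ?_
    filter_upwards [self_mem_nhdsWithin] with δ hδ
    have hδ0 : (0 : ℝ) < δ := hδ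
    rw [Function.comp_apply, Measure.addHaar_ball_of_pos volume (0 : E3) hδ0]
    simp [ENNReal.ofReal_pow hδ0.le]
  have hlim := tendsto_setLIntegral_zero hfin hvol
  obtain ⟨δ, hδη, hδ1, hδ0⟩ := ((hlim.eventually_le_const hη).and
    (Ioo_mem_nhdsGT (zero_lt_one' ℝ) : ∀ᶠ δ in 𝓝[>] (0 : ℝ), δ ∈ Set.Ioo (0 : ℝ) 1)).exists
  refine ⟨δ, hδ1, le_trans ?_ hδη⟩
  rw [← lintegral_indicator Metric.isOpen_ball.measurableSet]
  refine lintegral_mono fun z => (enorm_regKer_sub_le hs hδ1.le z).trans ?_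
  by_cases hz : z ∈ Metric.ball (0 : E3) δ
  · rw [Set.indicator_of_mem hz, Set.indicator_of_mem hz, hg,
      Set.indicator_of_mem (Metric.ball_subset_ball hδ0.le hz)]
  · rw [Set.indicator_of_notMem hz, Set.indicator_of_notMem hz]

end Kernel

/-! ### Potentials and bounds on the mass -/

/-- Bounded, integrable and strongly measurable potentials. -/
structure IsPotential (q : E3 → C2) : Prop where
  meas : StronglyMeasurable q
  bound : ∃ B : ℝ≥0∞, B ≠ ∞ ∧ ∀ y, ‖q y‖ₑ ≤ B
  integrable : Integrable q

theorem IsPotential.sub {q q' : E3 → C2} (h : IsPotential q) (h' : IsPotential q') :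
    IsPotential (q - q') := by
  obtain ⟨B, hB, hq⟩ := h.bound
  obtain ⟨B', hB', hq'⟩ := h'.bound
  exact ⟨h.meas.sub h'.meas, ⟨B + B', by simp [hB, hB'],
    fun y => enorm_sub_le.trans (add_le_add (hq y) (hq' y))⟩, h.integrable.sub h'.integrable⟩

section Mass

variable {κ κ' q : E3 → C2} {s : E3 → C2} {δ : ℝ}

theorem mass_le_of_ker_le {b : ℝ≥0∞} (hb : b ≠ ∞) (h : ∀ z, ‖κ z‖ₑ ≤ b) (q : E3 → C2) (x : E3) :
    mass κ q x ≤ b * ∫⁻ y, ‖q y‖ₑ := by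
  rw [← lintegral_const_mul' _ _ hb]
  exact lintegral_mono fun y => by gcongr; exact h _

theorem mass_le_of_pot_le {B : ℝ≥0∞} (hB : B ≠ ∞) (h : ∀ z, ‖q z‖ₑ ≤ B) (κ : E3 → C2) (x : E3) :
    mass κ q x ≤ (∫⁻ z, ‖κ z‖ₑ) * B := by
  rw [← lintegral_sub_right_eq_self (fun z => ‖κ z‖ₑ) x, ← lintegral_mul_const' _ _ hB]
  exact lintegral_mono fun y => by gcongr; exact h _

theorem mass_add_le (hκ : StronglyMeasurable κ) (hq : StronglyMeasurable q) (x : E3) :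
    mass (κ + κ') q x ≤ mass κ q x + mass κ' q x := by
  rw [mass, mass, mass, ← lintegral_add_left]
  · refine lintegral_mono fun y => ?_
    rw [← add_mul]
    gcongr
    exact enorm_add_le _ _
  · exact (hκ.comp_measurable (measurable_id.sub_const x)).enorm.mul hq.enorm

theorem enorm_regKer_le (hs : ∀ z, ‖s z‖ = ‖z‖) (hδ : 0 < δ) (z : E3) :
    ‖regKer s δ z‖ₑ ≤ ENNReal.ofReal (δ ^ 2)⁻¹ := by
  rw [← ofReal_norm]
  exact ENNReal.ofReal_le_ofReal (norm_regKer_le_const hs hδ z)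

theorem admissible_regKer (hs : Continuous s) (hs' : ∀ z, ‖s z‖ = ‖z‖) (hδ : 0 < δ)
    (hq : IsPotential q) : Admissible (regKer s δ) q where
  ker := stronglyMeasurable_regKer hs
  pot := hq.meas
  bound := ⟨_, ENNReal.mul_ne_top ENNReal.ofReal_ne_top hq.integrable.2.ne,
    mass_le_of_ker_le ENNReal.ofReal_ne_top (enorm_regKer_le hs' hδ) q⟩

theorem admissible_regKer_sub (hs : Continuous s) (hδ : ∫⁻ z, ‖(regKer s 0 - regKer s δ) z‖ₑ < ∞)
    (hq : IsPotential q) : Admissible (regKer s 0 - regKer s δ) q where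
  ker := (stronglyMeasurable_regKer hs).sub (stronglyMeasurable_regKer hs)
  pot := hq.meas
  bound := by
    obtain ⟨B, hB, h⟩ := hq.bound
    exact ⟨_, ENNReal.mul_ne_top hδ.ne hB, mass_le_of_pot_le hB h _⟩

/-- The singular kernel is an integrable piece, tested against the bounded `q`, plus a bounded
piece, tested against the integrable `q`. -/
theorem admissible_regKer_zero (hs : Continuous s) (hs' : ∀ z, ‖s z‖ = ‖z‖)
    (hq : IsPotential q) : Admissible (regKer s 0) q where
  ker := stronglyMeasurable_regKer hs
  pot := hq.meas
  bound := by
    obtain ⟨δ, hδ, hle⟩ := exists_lintegral_regKer_sub_le hs' zero_lt_one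
    have h1 := admissible_regKer_sub hs (hle.trans_lt (by simp)) hq
    have h2 := admissible_regKer hs hs' hδ hq
    obtain ⟨A, hA, hm⟩ := h1.bound
    obtain ⟨A', hA', hm'⟩ := h2.bound
    refine ⟨A + A', by simp [hA, hA'], fun x => ?_⟩
    have := mass_add_le (κ' := regKer s δ) h1.ker h1.pot x
    rw [sub_add_cancel] at this
    exact this.trans (add_le_add (hm x) (hm' x))

end Mass

/-! ### Cancellation from the oscillation -/

theorem osc_add_half_period {l : E3} (hl : l ≠ 0) (w : E3) :
    osc l (w + (Real.pi / ‖l‖ ^ 2) • l) = -osc l w := by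
  have h : ‖l‖ ≠ 0 := norm_ne_zero_iff.2 hl
  rw [osc, osc, inner_add_left, real_inner_smul_left, real_inner_self_eq_norm_sq,
    div_mul_cancel₀ _ (pow_ne_zero 2 h)]
  push_cast
  rw [mul_add, Complex.exp_add, mul_comm Complex.I (Real.pi : ℂ), Complex.exp_pi_mul_I]
  ring

/-- The half-period trick behind the Riemann-Lebesgue lemma. -/
theorem enorm_integral_osc_smul_le {l : E3} (hl : l ≠ 0) (G : E3 → C2) :
    ‖∫ w, osc l w • G w‖ₑ ≤ ∫⁻ w, ‖G w - G (w + (Real.pi / ‖l‖ ^ 2) • l)‖ₑ := by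
  set h : E3 := (Real.pi / ‖l‖ ^ 2) • l with hh
  set F : E3 → C2 := fun w => osc l w • G w with hF
  by_cases hI : Integrable F
  · have h1 : ∫ w, F (w + h) = ∫ w, F w := integral_add_right_eq_self F h
    have h2 : (2 : ℂ) • ∫ w, F w = ∫ w, osc l w • (G w - G (w + h)) := by
      -- One copy of the integral is shifted by half a period, where the exponential changes sign,
      -- so the sum contains a difference of values of `G`.
      rw [two_smul]
      nth_rewrite 2 [← h1]
      rw [← integral_add hI (hI.comp_add_right h)]
      refine integral_congr_ae (Eventually.of_forall fun w => ?_)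
      simp only [hF, hh, osc_add_half_period hl, neg_smul, smul_sub]
      abel
    have h3 : ‖∫ w, F w‖ₑ ≤ ‖(2 : ℂ) • ∫ w, F w‖ₑ := by
      rw [enorm_smul]
      refine le_mul_of_one_le_left' ?_
      rw [← ofReal_norm]
      simp
    refine h3.trans ?_
    rw [h2]
    refine (enorm_integral_le_lintegral_enorm _).trans (lintegral_mono fun w => ?_)
    rw [enorm_smul, enorm_osc, one_mul]
  -- Without integrability the Bochner integral is `0` by convention.
  · rw [integral_undef hI]
    simp

theorem exists_enorm_sub_le_of_uniformContinuous {F : E3 → C2} (hF : UniformContinuous F)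
    {ε : NNReal} (hε : 0 < ε) :
    ∃ d : ℝ, 0 < d ∧ ∀ a b, ‖a - b‖ ≤ d → ‖F a - F b‖ₑ ≤ ε := by
  obtain ⟨d, hd, h⟩ := Metric.uniformContinuous_iff.1 hF ε hε
  refine ⟨d / 2, by positivity, fun a b hab => ?_⟩
  have := h (a := a) (b := b) (by rw [dist_eq_norm]; linarith)
  rw [dist_eq_norm] at this
  rw [enorm_le_coe]
  exact this.le

/-- Telescoping, changing one factor at a time. It is applied to kernel, inner function and
potential at two nearby points. -/
theorem enorm_triple_sub_le (a a' H H' q q' : C2) {ε b Q T T' : ℝ≥0∞}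
    (h1 : ‖a - a'‖ₑ ≤ ε) (h2 : ‖q - q'‖ₑ ≤ ε) (h3 : ‖H - H'‖ₑ ≤ T')
    (ha' : ‖a'‖ₑ ≤ b) (hH : ‖H‖ₑ ≤ T) (hH' : ‖H'‖ₑ ≤ T) (hq : ‖q‖ₑ ≤ Q) :
    ‖a * (H * q) - a' * (H' * q')‖ₑ ≤
      (mulConst : ℝ≥0∞) ^ 2 * (ε * (T * Q) + b * (T' * Q) + b * (T * ε)) := by
  have key : ∀ c d e : C2, ‖c * (d * e)‖ₑ ≤ (mulConst : ℝ≥0∞) ^ 2 * (‖c‖ₑ * (‖d‖ₑ * ‖e‖ₑ)) := by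
    intro c d e
    calc ‖c * (d * e)‖ₑ ≤ mulConst * (‖c‖ₑ * ‖d * e‖ₑ) := enorm_mul_le_mulConst _ _
      _ ≤ mulConst * (‖c‖ₑ * (mulConst * (‖d‖ₑ * ‖e‖ₑ))) := by
        gcongr; exact enorm_mul_le_mulConst _ _
      _ = _ := by ring
  have : a * (H * q) - a' * (H' * q') =
      (a - a') * (H * q) + a' * ((H - H') * q) + a' * (H' * (q - q')) := by
    simp only [sub_mul, mul_sub]
    abel
  rw [this, mul_add, mul_add]
  refine (enorm_add_le _ _).trans (add_le_add ((enorm_add_le _ _).trans (add_le_add ?_ ?_)) ?_)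
  all_goals
    refine (key _ _ _).trans ?_
    gcongr

theorem enorm_one_C2 : ‖(1 : C2)‖ₑ = 1 := by
  rw [← ofReal_norm, norm_C2, Quaternion.re_one, Quaternion.imI_one, Quaternion.imJ_one,
    Quaternion.imK_one]
  simp

theorem majorant_le_of_ker_le {κ : E3 → C2} {b : ℝ≥0∞} (hb : b ≠ ∞) (h : ∀ z, ‖κ z‖ₑ ≤ b)
    (q : E3 → C2) (f : E3 → E3 → C2) (x k : E3) :
    majorant κ q f x k ≤ b * majorant (fun _ => 1) q f 0 k := by
  rw [majorant, majorant, ← lintegral_const_mul' _ _ hb]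
  refine lintegral_mono fun y => ?_
  rw [enorm_one_C2, one_mul, mul_assoc]
  gcongr
  exact h _

/-- The difference at two points becomes one integral with a difference of translated kernels, based
at `0`, so that bounds on kernels apply to increments. -/
theorem half_sub_half {κ q : E3 → C2} {u : E3 → E3} {f : E3 → E3 → C2} {x x' k : E3}
    (h : HalfConverges κ u q f x k) (h' : HalfConverges κ u q f x' k) :
    half κ u q f x k - half κ u q f x' k =
      half (fun z => κ (z - x) - κ (z - x')) u q f 0 k := by
  rw [half, half, half, ← integral_sub h h']
  simp only [sub_mul, sub_zero]

theorem admissible_one {q : E3 → C2} (hq : IsPotential q) : Admissible (fun _ => 1) q where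
  ker := stronglyMeasurable_const
  pot := hq.meas
  bound := ⟨_, ENNReal.mul_ne_top ENNReal.one_ne_top hq.integrable.2.ne,
    mass_le_of_ker_le ENNReal.one_ne_top (fun _ => enorm_one_C2.le) q⟩

/-- Composing with a compactly supported continuous potential and uniformly continuous kernels,
the oscillation makes the norm small for large frequencies. -/
theorem exists_normS_half_half_le {p : ℝ} (hp : 1 < p) {κ₁ κ₂ q q₂ : E3 → C2} {u v : E3 → E3}
    (hu : ∀ k, ‖u k‖ = ‖k‖) (hv : Continuous v) (hκ₁ : UniformContinuous κ₁)
    (hκ₂ : UniformContinuous κ₂) {b : ℝ≥0∞} (hb : b ≠ ∞) (hb₁ : ∀ z, ‖κ₁ z‖ₑ ≤ b)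
    (hb₂ : ∀ z, ‖κ₂ z‖ₑ ≤ b) (hq : Continuous q) (hqc : HasCompactSupport q)
    (hq₂ : IsPotential q₂) {η : ℝ≥0∞} (hη : 0 < η) :
    ∃ R₀ : ℝ, ∀ R, R₀ ≤ R → ∀ f, MemS p R f →
      normS p R (half κ₁ u q (half κ₂ v q₂ f)) ≤ η * normS p R f := by
  obtain ⟨Q, hQ⟩ := hqc.exists_bound_of_continuous hq
  obtain ⟨ρ, hρ⟩ := hqc.isCompact.isBounded.subset_closedBall (0 : E3)
  set C : ℝ≥0∞ := (mulConst : ℝ≥0∞) with hC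
  have hCtop : C ≠ ∞ := by simp [hC]
  set V : ℝ≥0∞ := volume (Metric.closedBall (0 : E3) (ρ + 1)) with hV
  have hVtop : V ≠ ∞ := measure_closedBall_lt_top.ne
  set I : ℝ≥0∞ := mass (fun _ => 1) q₂ 0 with hI
  obtain ⟨A, hA, hAm⟩ := (admissible_one hq₂).bound
  have hItop : I ≠ ∞ := ((hAm 0).trans_lt hA.lt_top).ne
  set Q' : ℝ≥0∞ := ENNReal.ofReal Q with hQ'
  have hqQ : ∀ y, ‖q y‖ₑ ≤ Q' := fun y => by
    rw [← ofReal_norm]; exact ENNReal.ofReal_le_ofReal (hQ y)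
  -- Each of the three telescoped terms carries exactly one `ε` and one `Φ`; `K` is what remains
  -- after factoring them out and integrating over the ball of radius `ρ + 1`.
  set K : ℝ≥0∞ := C ^ 2 * (C ^ 2 * b * Q' + b * (C ^ 2 * Q') + b * (C ^ 2 * b)) * V with hK
  have hKtop : K ≠ ∞ := by
    have h2 : C ^ 2 ≠ ∞ := ENNReal.pow_ne_top hCtop
    have h3 : Q' ≠ ∞ := ENNReal.ofReal_ne_top
    simp only [hK]
    finiteness
  obtain ⟨ε, hε, hεη⟩ := ENNReal.exists_nnreal_pos_mul_lt (ENNReal.mul_ne_top hKtop hItop) hη.ne'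
  obtain ⟨d₁, hd₁, hm₁⟩ := exists_enorm_sub_le_of_uniformContinuous hκ₁ hε
  obtain ⟨d₂, hd₂, hm₂⟩ := exists_enorm_sub_le_of_uniformContinuous hκ₂ hε
  obtain ⟨d₃, hd₃, hm₃⟩ := exists_enorm_sub_le_of_uniformContinuous
    (hqc.uniformContinuous_of_continuous hq) hε
  set d := min (min d₁ d₂) (min d₃ 1) with hd
  have hd0 : 0 < d := by simp [hd, hd₁, hd₂, hd₃]
  -- For `|k| > R ≥ π/d` the half-period shift has length `π/|k| ≤ d`.
  refine ⟨Real.pi / d, fun R hR f hf => ?_⟩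
  have hR0 : 0 < R := lt_of_lt_of_le (by positivity) hR
  refine essSup_le_of_ae_le _ (Eventually.of_forall fun x => ?_)
  have main : ∀ᵐ k ∂(kMeasure R), ‖half κ₁ u q (half κ₂ v q₂ f) x k‖ₑ ≤
      (ε * K) * majorant (fun _ => 1) q₂ f 0 k := by
    obtain ⟨g, hg, hfg⟩ := exists_stronglyMeasurable_eqS hf.1
    have hkR : ∀ᵐ k ∂(kMeasure R), R < ‖k‖ :=
      ae_restrict_mem (measurableSet_lt measurable_const measurable_norm)
    have hmaj := ae_majorant_eq (κ := κ₂) (q := q₂) hfg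
    have hconv := ae_halfConverges_iff (κ := κ₂) (q := q₂) (u := v) hfg
    have hfin := ae_majorant_lt_top hp (admissible_one hq₂) hf 0
    filter_upwards [hkR, hmaj, hconv, hfin] with k hk hmaj hconv hfin
    set Φ := majorant (fun _ => 1) q₂ f 0 k with hΦ
    set H : E3 → C2 := fun w => half κ₂ v q₂ f w k with hH
    have hcv : ∀ w, HalfConverges κ₂ v q₂ f w k := fun w => by
      rw [hconv w]
      refine halfConverges_of_majorant_lt_top hv hκ₂.continuous.stronglyMeasurable hq₂.meas hg ?_
      rw [← hmaj w]
      exact (majorant_le_of_ker_le hb hb₂ q₂ f w k).trans_lt (ENNReal.mul_lt_top hb.lt_top hfin)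
    have hHb : ∀ w, ‖H w‖ₑ ≤ C ^ 2 * (b * Φ) := fun w =>
      (enorm_half_le κ₂ q₂ v f w k).trans
        (mul_le_mul' le_rfl (majorant_le_of_ker_le hb hb₂ q₂ f w k))
    have hHd : ∀ w w', ‖w - w'‖ ≤ d → ‖H w - H w'‖ₑ ≤ C ^ 2 * (ε * Φ) := fun w w' hw => by
      simp only [hH]
      rw [half_sub_half (hcv w) (hcv w')]
      refine (enorm_half_le _ q₂ v f 0 k).trans (mul_le_mul' le_rfl
        (majorant_le_of_ker_le (by simp) (fun z => hm₂ _ _ ?_) q₂ f 0 k))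
      rw [sub_sub_sub_cancel_left, norm_sub_rev]
      exact hw.trans ((min_le_left _ _).trans (min_le_right _ _))
    have huk : u k ≠ 0 := by
      rw [← norm_ne_zero_iff, hu]
      linarith
    set h : E3 := (Real.pi / ‖u k‖ ^ 2) • u k with hh
    have hhd : ‖h‖ ≤ d := by
      have hk0 : 0 < ‖k‖ := hR0.trans hk
      rw [hh, norm_smul, hu, Real.norm_eq_abs, abs_of_pos (by positivity)]
      rw [div_le_iff₀ hd0] at hR
      rw [show Real.pi / ‖k‖ ^ 2 * ‖k‖ = Real.pi / ‖k‖ by field_simp, div_le_iff₀ hk0]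
      nlinarith
    set G : E3 → C2 := fun w => κ₁ (w - x) * (H w * q w) with hG
    have hint : half κ₁ u q (half κ₂ v q₂ f) x k = ∫ w, osc (u k) w • G w := by
      rw [half]
      simp only [C2_mul_smul, hG, hH]
    have hGd : ∀ w, ‖G w - G (w + h)‖ₑ ≤
        (Metric.closedBall (0 : E3) (ρ + 1)).indicator
          (fun _ => C ^ 2 * (ε * (C ^ 2 * (b * Φ) * Q') + b * (C ^ 2 * (ε * Φ) * Q') +
            b * (C ^ 2 * (b * Φ) * ε))) w := by
      intro w
      have hwh : ‖w - (w + h)‖ ≤ d := by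
        rw [sub_add_cancel_left, norm_neg]; exact hhd
      -- The shift has length at most `1`, so outside the ball of radius `ρ + 1` the potential
      -- vanishes at both `w` and `w + h`.
      by_cases hw : w ∈ Metric.closedBall (0 : E3) (ρ + 1)
      · rw [Set.indicator_of_mem hw]
        refine enorm_triple_sub_le _ _ _ _ _ _ (hm₁ _ _ ?_) (hm₃ _ _ ?_) (hHd _ _ hwh) (hb₁ _)
          (hHb _) (hHb _) (hqQ _)
        · rw [sub_sub_sub_cancel_right]
          exact hwh.trans ((min_le_left _ _).trans (min_le_left _ _))
        · exact hwh.trans ((min_le_right _ _).trans (min_le_left _ _))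
      · rw [Set.indicator_of_notMem hw]
        have hw' : ρ + 1 < ‖w‖ := by simpa using hw
        have hh1 : ‖h‖ ≤ 1 := hhd.trans ((min_le_right _ _).trans (min_le_right _ _))
        have hz : ∀ z : E3, ρ < ‖z‖ → q z = 0 := fun z hz => by
          by_contra hne
          have := hρ (subset_tsupport q hne)
          rw [mem_closedBall_zero_iff] at this
          linarith
        have hwn : ρ < ‖w + h‖ := by
          have := norm_sub_le (w + h) h
          rw [add_sub_cancel_right] at this
          linarith
        simp [hG, hz w (by linarith), hz _ hwn]
    rw [hint]
    refine (enorm_integral_osc_smul_le huk G).trans ((lintegral_mono hGd).trans ?_)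
    rw [lintegral_indicator_const Metric.isClosed_closedBall.measurableSet, ← hV]
    refine le_of_eq ?_
    rw [hK]
    ring
  -- Schur's test with kernel `1` turns the bound for almost every `k` into an `L^p_k` bound with
  -- constant `ε K I < η`.
  refine (eLpNorm_le_mass_mul_normS hp stronglyMeasurable_const hq₂.meas hf.1 0
    (ENNReal.mul_ne_top (by simp) hKtop) main).trans ?_
  rw [mul_assoc (ε : ℝ≥0∞) K]
  exact mul_le_mul' hεη.le le_rfl

/-! ### Approximation of the singular operators -/

theorem normS_half_half_le {p R : ℝ} (hp : 1 < p) {κ κ' q q' : E3 → C2} {u v : E3 → E3}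
    (hv : Continuous v) (h : Admissible κ q) (h' : Admissible κ' q') {A A' : ℝ≥0∞}
    (hA : ∀ x, mass κ q x ≤ A) (hA' : ∀ x, mass κ' q' x ≤ A') {f : E3 → E3 → C2}
    (hf : MemS p R f) :
    normS p R (half κ u q (half κ' v q' f)) ≤
      A * ((mulConst : ℝ≥0∞) ^ 2 * (mulConst : ℝ≥0∞) ^ 2 * A') * normS p R f := by
  have h1 := normS_half_le hp u h.ker h.pot (hf.half hp hv h').1 hA
  have h2 := normS_half_le hp v h'.ker h'.pot hf.1 hA'
  calc _ ≤ _ := h1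
    _ ≤ (mulConst : ℝ≥0∞) ^ 2 * A * ((mulConst : ℝ≥0∞) ^ 2 * A' * normS p R f) := by gcongr
    _ = _ := by ring

theorem IsPotential.of_hasCompactSupport {q : E3 → C2} (hq : Continuous q)
    (hqc : HasCompactSupport q) : IsPotential q where
  meas := hq.stronglyMeasurable
  bound := by
    obtain ⟨Q, hQ⟩ := hqc.exists_bound_of_continuous hq
    exact ⟨ENNReal.ofReal Q, ENNReal.ofReal_ne_top, fun y => by
      rw [← ofReal_norm]; exact ENNReal.ofReal_le_ofReal (hQ y)⟩
  integrable := hq.integrable_of_hasCompactSupport hqc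

theorem exists_normS_regKer_half_half_le {p : ℝ} (hp : 1 < p) {s₁ s₂ q₁ q₂ : E3 → C2}
    {u v : E3 → E3} (hu : Continuous u) (hu' : ∀ k, ‖u k‖ = ‖k‖) (hv : Continuous v)
    (hs₁ : Continuous s₁) (hs₁' : ∀ z, ‖s₁ z‖ = ‖z‖) (hs₂ : Continuous s₂)
    (hs₂' : ∀ z, ‖s₂ z‖ = ‖z‖) (hq₁ : IsPotential q₁) (hq₂ : IsPotential q₂) {η : ℝ≥0∞}
    (hη : 0 < η) :
    ∃ R₀ : ℝ, ∀ R, R₀ ≤ R → ∀ f, MemS p R f →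
      normS p R (half (regKer s₁ 0) u q₁ (half (regKer s₂ 0) v q₂ f)) ≤ η * normS p R f := by
  -- Three approximation errors and one oscillatory term receive `η / 4` each. The order of choices
  -- matters: `A₂` depends on `δ₂` and enters the choice of `δ₁`, and both `A₂` and `δ₁` enter the
  -- tolerance for the potential.
  have hη4 : 0 < η / 4 := ENNReal.div_pos hη.ne' (by simp)
  set D : ℝ≥0∞ := (mulConst : ℝ≥0∞) ^ 2 * (mulConst : ℝ≥0∞) ^ 2 with hD
  have hDtop : D ≠ ∞ := by simp only [hD]; finiteness
  have hadm₁ := admissible_regKer_zero hs₁ hs₁' hq₁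
  have hadm₂ := admissible_regKer_zero hs₂ hs₂' hq₂
  obtain ⟨A₁, hA₁, hm₁⟩ := hadm₁.bound
  obtain ⟨B₁, hB₁, hqB₁⟩ := hq₁.bound
  obtain ⟨B₂, hB₂, hqB₂⟩ := hq₂.bound
  -- regularise the inner kernel
  obtain ⟨t₂, ht₂, hη₂⟩ := ENNReal.exists_nnreal_pos_mul_lt (a := A₁ * (D * B₂))
    (by finiteness) hη4.ne'
  obtain ⟨δ₂, hδ₂, hJ₂⟩ := exists_lintegral_regKer_sub_le hs₂'
    (ENNReal.coe_pos.2 ht₂)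
  have hsub₂ := admissible_regKer_sub hs₂ (hJ₂.trans_lt ENNReal.coe_lt_top) hq₂
  have hreg₂ := admissible_regKer hs₂ hs₂' hδ₂ hq₂
  obtain ⟨A₂, hA₂, hm₂⟩ := hreg₂.bound
  -- regularise the outer kernel
  obtain ⟨t₁, ht₁, hη₁⟩ := ENNReal.exists_nnreal_pos_mul_lt (a := B₁ * (D * A₂))
    (by finiteness) hη4.ne'
  obtain ⟨δ₁, hδ₁, hJ₁⟩ := exists_lintegral_regKer_sub_le hs₁'
    (ENNReal.coe_pos.2 ht₁)
  have hsub₁ := admissible_regKer_sub hs₁ (hJ₁.trans_lt ENNReal.coe_lt_top) hq₁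
  have hreg₁ := admissible_regKer hs₁ hs₁' hδ₁ hq₁
  -- regularise the outer potential
  obtain ⟨t, ht, hηt⟩ := ENNReal.exists_nnreal_pos_mul_lt
    (a := ENNReal.ofReal (δ₁ ^ 2)⁻¹ * (D * A₂)) (by finiteness) hη4.ne'
  obtain ⟨q, hqc, hqt, hq, -⟩ := hq₁.integrable.exists_hasCompactSupport_lintegral_sub_le
    (ENNReal.coe_pos.2 ht).ne'
  have hqp := IsPotential.of_hasCompactSupport hq hqc
  have hregsub := admissible_regKer hs₁ hs₁' hδ₁ (hq₁.sub hqp)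
  have hregq := admissible_regKer hs₁ hs₁' hδ₁ hqp
  obtain ⟨R₀, hR₀⟩ := exists_normS_half_half_le hp (u := u) (v := v) hu' hv
    (uniformContinuous_regKer hs₁ hs₁' hδ₁) (uniformContinuous_regKer hs₂ hs₂' hδ₂)
    (b := ENNReal.ofReal (δ₁ ^ 2)⁻¹ + ENNReal.ofReal (δ₂ ^ 2)⁻¹) (by finiteness)
    (fun z => (enorm_regKer_le hs₁' hδ₁ z).trans le_self_add)
    (fun z => (enorm_regKer_le hs₂' hδ₂ z).trans le_add_self) hq hqc hq₂ hη4
  refine ⟨R₀, fun R hR f hf => ?_⟩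
  set H := half (regKer s₂ δ₂) v q₂ f with hH
  set E := half (regKer s₂ 0 - regKer s₂ δ₂) v q₂ f with hE
  have hHS : MemS p R H := hf.half hp hv hreg₂
  have hES : MemS p R E := hf.half hp hv hsub₂
  -- Splitting an integral requires absolute convergence of both pieces, so these decompositions
  -- hold only almost everywhere.
  have e1 : EqS R (half (regKer s₂ 0) v q₂ f) (E + H) := by
    have := half_add_ker hp hv hsub₂ hreg₂ hf
    rwa [sub_add_cancel] at this
  have e2 : EqS R (half (regKer s₁ 0) u q₁ (half (regKer s₂ 0) v q₂ f))
      (half (regKer s₁ 0) u q₁ E + half (regKer s₁ 0) u q₁ H) :=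
    (half_eqS e1).trans (half_add hp hu hadm₁ hES hHS)
  have e3 : EqS R (half (regKer s₁ 0) u q₁ H)
      (half (regKer s₁ 0 - regKer s₁ δ₁) u q₁ H + half (regKer s₁ δ₁) u q₁ H) := by
    have := half_add_ker hp hu hsub₁ hreg₁ hHS
    rwa [sub_add_cancel] at this
  have e4 : EqS R (half (regKer s₁ δ₁) u q₁ H)
      (half (regKer s₁ δ₁) u (q₁ - q) H + half (regKer s₁ δ₁) u q H) := by
    have := half_add_pot hp hu hregsub hregq hHS
    rwa [sub_add_cancel] at this
  have b1 : normS p R (half (regKer s₁ 0) u q₁ E) ≤ η / 4 * normS p R f := by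
    refine (normS_half_half_le hp hv hadm₁ hsub₂ hm₁
      (fun x => (mass_le_of_pot_le hB₂ hqB₂ _ x).trans (mul_le_mul' hJ₂ le_rfl)) hf).trans ?_
    refine mul_le_mul' (le_trans (le_of_eq ?_) hη₂.le) le_rfl
    ring
  have b2 : normS p R (half (regKer s₁ 0 - regKer s₁ δ₁) u q₁ H) ≤ η / 4 * normS p R f := by
    refine (normS_half_half_le hp hv hsub₁ hreg₂
      (fun x => (mass_le_of_pot_le hB₁ hqB₁ _ x).trans (mul_le_mul' hJ₁ le_rfl)) hm₂ hf).trans ?_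
    refine mul_le_mul' (le_trans (le_of_eq ?_) hη₁.le) le_rfl
    ring
  have b3 : normS p R (half (regKer s₁ δ₁) u (q₁ - q) H) ≤ η / 4 * normS p R f := by
    refine (normS_half_half_le hp hv hregsub hreg₂
      (fun x => (mass_le_of_ker_le ENNReal.ofReal_ne_top (enorm_regKer_le hs₁' hδ₁) _ x).trans
        (mul_le_mul' le_rfl hqt)) hm₂ hf).trans ?_
    refine mul_le_mul' (le_trans (le_of_eq ?_) hηt.le) le_rfl
    ring
  have b4 := hR₀ R hR f hf
  have hp1 : 1 ≤ p := hp.le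
  rw [normS_congr e2]
  refine (normS_add_le hp1 (hES.half hp hu hadm₁) (hHS.half hp hu hadm₁)).trans ?_
  rw [normS_congr e3]
  refine (add_le_add b1 (normS_add_le hp1 (hHS.half hp hu hsub₁)
    (hHS.half hp hu hreg₁))).trans ?_
  rw [normS_congr e4]
  refine (add_le_add le_rfl (add_le_add b2 ((normS_add_le hp1 (hHS.half hp hu hregsub)
    (hHS.half hp hu hregq)).trans (add_le_add b3 b4)))).trans (le_of_eq ?_)
  rw [← add_mul, ← add_mul, ← add_mul]
  congr 1
  calc η / 4 + (η / 4 + (η / 4 + η / 4)) = 4 * (η / 4) := by ring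
    _ = η := ENNReal.mul_div_cancel (by simp) (by simp)

/-- The operator norm is an infimum of admissible constants, so each `η` that is eventually
admissible bounds it. -/
theorem tendsto_opNormS {p : ℝ} {M : (E3 → E3 → C2) → (E3 → E3 → C2)}
    (h : ∀ η : ℝ≥0∞, 0 < η → ∃ R₀ : ℝ, ∀ R, R₀ ≤ R → ∀ f, MemS p R f →
      normS p R (M f) ≤ η * normS p R f) :
    Tendsto (fun R : ℝ => opNormS p R M) atTop (𝓝 0) := by
  rw [ENNReal.tendsto_nhds_zero]
  intro η hη
  obtain ⟨R₀, hR₀⟩ := h η hη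
  filter_upwards [eventually_ge_atTop R₀] with R hR
  exact sInf_le fun f hf => hR₀ R hR f hf

/-! ### Identification of the concrete operators -/

theorem toC2_sub (x y : E3) : toC2 (x - y) = toC2 x - toC2 y := by
  have h0 : (toC2 (x - y)).re = (toC2 x).re - (toC2 y).re := by simp [toC2]
  have h1 : (toC2 (x - y)).imI = (toC2 x).imI - (toC2 y).imI := by simp [toC2]
  have h2 : (toC2 (x - y)).imJ = (toC2 x).imJ - (toC2 y).imJ := by simp [toC2]
  have h3 : (toC2 (x - y)).imK = (toC2 x).imK - (toC2 y).imK := by simp [toC2]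
  exact Quaternion.ext _ _ h0 h1 h2 h3

theorem norm_toC2 (x : E3) : ‖toC2 x‖ = ‖x‖ := by
  rw [norm_C2, EuclideanSpace.norm_eq, Fin.sum_univ_three]
  simp [toC2]

theorem norm_star_C2 (a : C2) : ‖star a‖ = ‖a‖ := by
  simp [norm_C2]

theorem norm_star_toC2 (x : E3) : ‖star (toC2 x)‖ = ‖x‖ := by
  rw [norm_star_C2, norm_toC2]

theorem continuous_toC2 : Continuous toC2 :=
  (Isometry.of_dist_eq fun x y => by
    rw [dist_eq_norm, dist_eq_norm, ← toC2_sub, norm_toC2]).continuous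

theorem continuous_star_toC2 : Continuous fun x => star (toC2 x) :=
  (Isometry.of_dist_eq fun x y => by
    have h : star (toC2 (x - y)) = star (toC2 x) - star (toC2 y) := by
      rw [toC2_sub]
      exact star_sub (toC2 x) (toC2 y)
    rw [dist_eq_norm, dist_eq_norm, ← h, norm_star_toC2]).continuous

theorem kerT_eq_regKer (x y : E3) : kerT x y = regKer (fun z => star (toC2 z)) 0 (y - x) := by
  rw [kerT, regKer, max_eq_left (norm_nonneg _)]

theorem kerTbar_eq_regKer (x y : E3) : kerTbar x y = regKer toC2 0 (y - x) := by
  rw [kerTbar, regKer, max_eq_left (norm_nonneg _)]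

/-- Integrability comes from boundedness on a set of finite measure. Setting a measurable version to
zero where it exceeds the essential supremum makes the bound hold everywhere. -/
theorem exists_isPotential_ae_eq {Ω : Set E3} (hΩ : Bornology.IsBounded Ω) {q : E3 → C2}
    (hq : MemLp q ⊤ volume) (hqΩ : ∀ x, x ∉ Ω → q x = 0) :
    ∃ q', IsPotential q' ∧ q =ᵐ[volume] q' := by
  obtain ⟨ρ, hρ⟩ := hΩ.subset_closedBall (0 : E3)
  have hint : Integrable q := by
    have : IsFiniteMeasure ((volume : Measure E3).restrict (Metric.closedBall 0 ρ)) :=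
      ⟨by simpa using measure_closedBall_lt_top (μ := (volume : Measure E3)) (x := 0) (r := ρ)⟩
    rw [← integrableOn_iff_integrable_of_support_subset (s := Metric.closedBall (0 : E3) ρ)]
    · exact memLp_one_iff_integrable.1 ((hq.restrict _).mono_exponent le_top)
    · intro x hx
      by_contra h
      exact hx (hqΩ x fun hxΩ => h (hρ hxΩ))
  set g := hq.1.mk q with hg
  have hgm : StronglyMeasurable g := hq.1.stronglyMeasurable_mk
  have hqg : q =ᵐ[volume] g := hq.1.ae_eq_mk
  set B := eLpNormEssSup q volume with hB
  have hBtop : B ≠ ∞ := by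
    have := hq.2
    rw [eLpNorm_exponent_top] at this
    exact this.ne
  have hae : q =ᵐ[volume] {x | ‖g x‖ₑ ≤ B}.indicator g := by
    filter_upwards [hqg, enorm_ae_le_eLpNormEssSup q volume] with x h1 h2
    rw [Set.indicator_of_mem (by rw [Set.mem_ofPred_eq, ← h1]; exact h2), h1]
  refine ⟨_, ⟨hgm.indicator (measurableSet_le hgm.enorm measurable_const),
    ⟨B, hBtop, fun y => ?_⟩, hint.congr hae⟩, hae⟩
  by_cases hy : y ∈ {x | ‖g x‖ₑ ≤ B}
  · rw [Set.indicator_of_mem hy]; exact hy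
  · rw [Set.indicator_of_notMem hy]; simp

/-- Changing the potential on a null set leaves every integral over `y` unchanged, so the two sides
agree at every point and not merely as classes. -/
theorem halfT_eq_half {q q' : E3 → C2} (h : q =ᵐ[volume] q') :
    halfT q = half (regKer (fun z => star (toC2 z)) 0) (fun k => -k) q' := by
  ext1 f
  ext1 x
  ext1 k
  refine integral_congr_ae (h.mono fun y hy => ?_)
  simp only [kerT_eq_regKer, argT, hy]

theorem halfTbar_eq_half {q q' : E3 → C2} (h : q =ᵐ[volume] q') :
    halfTbar q = half (regKer toC2 0) (fun k => k) q' := by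
  ext1 f
  ext1 x
  ext1 k
  refine integral_congr_ae (h.mono fun y hy => ?_)
  simp only [kerTbar_eq_regKer, argTbar, hy]

theorem kerConverges_kerT_iff {q q' : E3 → C2} (h : q =ᵐ[volume] q')
    (f : E3 → E3 → C2) (x k : E3) :
    KerConverges kerT (argT q k (fun y => f y k)) x ↔
      HalfConverges (regKer (fun z => star (toC2 z)) 0) (fun k => -k) q' f x k := by
  refine integrable_congr (h.mono fun y hy => ?_)
  simp only [kerT_eq_regKer, argT, hy]

theorem kerConverges_kerTbar_iff {q q' : E3 → C2} (h : q =ᵐ[volume] q')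
    (f : E3 → E3 → C2) (x k : E3) :
    KerConverges kerTbar (argTbar q k (fun y => f y k)) x ↔
      HalfConverges (regKer toC2 0) (fun k => k) q' f x k := by
  refine integrable_congr (h.mono fun y hy => ?_)
  simp only [kerTbar_eq_regKer, argTbar, hy]

end Contractions
end

/-- Contraction property of `M¹` and `M²` on `S = L^∞_x(L^p_k(|k| > R))` as `R → ∞`. -/
theorem lemma3p1 (p : ℝ) (hp : 2 < p) (Ω : Set Contractions.E3)
    (hΩ : Bornology.IsBounded Ω) (q₁ q₂ : Contractions.E3 → Contractions.C2)
    (hq₁ : MeasureTheory.MemLp q₁ ⊤ MeasureTheory.volume)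
    (hq₂ : MeasureTheory.MemLp q₂ ⊤ MeasureTheory.volume)
    (hq₁Ω : ∀ x, x ∉ Ω → q₁ x = 0) (hq₂Ω : ∀ x, x ∉ Ω → q₂ x = 0) :
    (∀ R : ℝ, 0 < R → ∀ f : Contractions.E3 → Contractions.E3 → Contractions.C2,
      Contractions.MemS p R f → ∀ᵐ z ∂(Contractions.xkMeasure R),
        (Contractions.KerConverges Contractions.kerTbar
            (Contractions.argTbar q₂ z.2 (fun y => f y z.2)) z.1 ∧
          Contractions.KerConverges Contractions.kerT
            (Contractions.argT q₁ z.2 (fun y => Contractions.halfTbar q₂ f y z.2)) z.1) ∧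
        (Contractions.KerConverges Contractions.kerT
            (Contractions.argT q₁ z.2 (fun y => f y z.2)) z.1 ∧
          Contractions.KerConverges Contractions.kerTbar
            (Contractions.argTbar q₂ z.2 (fun y => Contractions.halfT q₁ f y z.2)) z.1)) ∧
    (∀ R : ℝ, 0 < R →
      Contractions.IsLinearOperatorOnS p R (Contractions.M1 q₁ q₂) ∧
      Contractions.IsLinearOperatorOnS p R (Contractions.M2 q₁ q₂)) ∧
    Tendsto (fun R : ℝ => Contractions.opNormS p R (Contractions.M1 q₁ q₂)) atTop (𝓝 0) ∧
    Tendsto (fun R : ℝ => Contractions.opNormS p R (Contractions.M2 q₁ q₂)) atTop (𝓝 0) := by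
  have hp1 : 1 < p := by linarith
  obtain ⟨r₁, hr₁, he₁⟩ := Contractions.exists_isPotential_ae_eq hΩ hq₁ hq₁Ω
  obtain ⟨r₂, hr₂, he₂⟩ := Contractions.exists_isPotential_ae_eq hΩ hq₂ hq₂Ω
  have hT := Contractions.admissible_regKer_zero Contractions.continuous_star_toC2
    Contractions.norm_star_toC2 hr₁
  have hTbar := Contractions.admissible_regKer_zero Contractions.continuous_toC2
    Contractions.norm_toC2 hr₂
  have hu : Continuous fun k : Contractions.E3 => -k := continuous_neg
  have hv : Continuous fun k : Contractions.E3 => k := continuous_id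
  simp only [Contractions.kerConverges_kerT_iff he₁, Contractions.kerConverges_kerTbar_iff he₂]
  have hM1 : Contractions.M1 q₁ q₂ = fun f =>
      Contractions.halfT q₁ (Contractions.halfTbar q₂ f) := rfl
  have hM2 : Contractions.M2 q₁ q₂ = fun f =>
      Contractions.halfTbar q₂ (Contractions.halfT q₁ f) := rfl
  rw [hM1, hM2, Contractions.halfT_eq_half he₁, Contractions.halfTbar_eq_half he₂]
  refine ⟨fun R _ f hf => ?_, fun R _ => ⟨?_, ?_⟩, ?_, ?_⟩
  · filter_upwards [Contractions.ae_halfConverges hp1 hv hTbar hf,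
      Contractions.ae_halfConverges hp1 hu hT (hf.half hp1 hv hTbar),
      Contractions.ae_halfConverges hp1 hu hT hf,
      Contractions.ae_halfConverges hp1 hv hTbar (hf.half hp1 hu hT)] with z h1 h2 h3 h4
    exact ⟨⟨h1, h2⟩, h3, h4⟩
  · exact (Contractions.isLinearOperatorOnS_half hp1 hu hT).comp hp1.le
      (Contractions.isLinearOperatorOnS_half hp1 hv hTbar)
  · exact (Contractions.isLinearOperatorOnS_half hp1 hv hTbar).comp hp1.le
      (Contractions.isLinearOperatorOnS_half hp1 hu hT)
  · exact Contractions.tendsto_opNormS fun η hη =>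
      Contractions.exists_normS_regKer_half_half_le hp1 hu norm_neg hv
        Contractions.continuous_star_toC2 Contractions.norm_star_toC2
        Contractions.continuous_toC2 Contractions.norm_toC2 hr₁ hr₂ hη
  -- The same estimate with the two kernels, potentials and signs of the frequency exchanged.
  · exact Contractions.tendsto_opNormS fun η hη =>
      Contractions.exists_normS_regKer_half_half_le hp1 hv (fun _ => rfl) hu
        Contractions.continuous_toC2 Contractions.norm_toC2
        Contractions.continuous_star_toC2 Contractions.norm_star_toC2 hr₂ hr₁ hη
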